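/- Let $g \ge 0$ be an integer and let $L$ be an integral symplectic form on $\mathbb{Z}^{2g}$, that is, a skew-symmetric integer $2g \times 2g$ matrix with $\det L \neq 0$. For $R = \mathbb{Z}$ or $\mathbb{Q}$ let $\mathrm{Sp}(2g, R, L)$ be the group of invertible $2g \times 2g$ matrices $A$ over $R$ with $A^T L A = L$. Call a real square matrix Perron–Frobenius if all its entries are nonnegative and some positive power of it has strictly positive entries. Let $M \in \mathrm{Sp}(2g, \mathbb{Z}, L)$, and suppose that $M$ has a real eigenvalue $\lambda$ of algebraic multiplicity $1$ with $|\lambda| > 1$ such that $|\mu| < |\lambda|$ for every other complex eigenvalue $\mu$ of $M$. Then there are an integer $n \ge 1$ and an integer matrix $B$ with $\det B \ne 0$, of the form $B = aS$ with $a$ a positive integer and $S \in \mathrm{Sp}(2g, \mathbb{Q}, L)$, such that $B^{-1} M^n B$ is a Perron–Frobenius matrix with integer entries that lies in $\mathrm{Sp}(2g, \mathbb{Z}, L)$. -/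

import Mathlib

/-- An integral symplectic form on `ℤ^m`, given by its Gram matrix: skew-symmetric (over `ℤ` this
is the same as alternating) and non-degenerate. It need not be unimodular. -/
structure IsIntegralSymplecticForm {m : ℕ} (L : Matrix (Fin m) (Fin m) ℤ) : Prop where
  skew : L.transpose = -L
  nondegenerate : L.det ≠ 0

/-- The group `Sp(m, R, L)` of all `m × m` matrices over `R` that preserve the bilinear form with
Gram matrix `L`. If `R = ℤ` and `det L ≠ 0`, every integer matrix `A` with `Aᵀ L A = L` has
determinant `±1`, so that asking for invertibility over `ℤ` excludes nothing. -/
def formPreservingGroup {m : ℕ} {R : Type*} [CommRing R] (L : Matrix (Fin m) (Fin m) R) :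
    Subgroup (Matrix.GeneralLinearGroup (Fin m) R) where
  carrier := {A | A.val.transpose * L * A.val = L}
  one_mem' := by simp
  mul_mem' := by
    intro A B hA hB
    simp only [Set.mem_ofPred_eq, Units.val_mul, Matrix.transpose_mul] at hA hB ⊢
    calc B.val.transpose * A.val.transpose * L * (A.val * B.val)
        = B.val.transpose * (A.val.transpose * L * A.val) * B.val := by
          simp only [Matrix.mul_assoc]
      _ = L := by rw [hA, hB]
  inv_mem' := by
    intro A hA
    simp only [Set.mem_ofPred_eq] at hA ⊢
    have h1 : A.val * (A⁻¹).val = 1 := by rw [← Units.val_mul]; simp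
    have h2 : (A⁻¹).val.transpose * A.val.transpose = 1 := by
      rw [← Matrix.transpose_mul, h1, Matrix.transpose_one]
    calc (A⁻¹).val.transpose * L * (A⁻¹).val
        = (A⁻¹).val.transpose * (A.val.transpose * L * A.val) * (A⁻¹).val := by rw [hA]
      _ = ((A⁻¹).val.transpose * A.val.transpose) * L * (A.val * (A⁻¹).val) := by
          simp only [Matrix.mul_assoc]
      _ = L := by rw [h1, h2, Matrix.one_mul, Matrix.mul_one]

/-- The real number `lam` is an eigenvalue of the integer matrix `M`, of algebraic multiplicity 1
and of modulus greater than 1, and every other complex eigenvalue of `M` has strictly smaller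
modulus. -/
structure IsSimpleDominatingEigenvalue {m : ℕ} (M : Matrix (Fin m) (Fin m) ℤ) (lam : ℝ) :
    Prop where
  mem_spectrum : (lam : ℂ) ∈ spectrum ℂ (M.map (Int.cast : ℤ → ℂ))
  simple : (M.map (Int.cast : ℤ → ℂ)).charpoly.rootMultiplicity (lam : ℂ) = 1
  one_lt_abs : 1 < |lam|
  dominates : ∀ z ∈ spectrum ℂ (M.map (Int.cast : ℤ → ℂ)), z ≠ (lam : ℂ) → ‖z‖ < |lam|

open Filter Topology Matrix

/-- In a complex Banach algebra, an element whose spectrum lies in the open unit disc has powers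
tending to zero. -/
theorem tendsto_pow_zero_of_spectrum_lt_one {A : Type*} [NormedRing A] [NormedAlgebra ℂ A]
    [CompleteSpace A] [Nontrivial A] (a : A) (h : ∀ z ∈ spectrum ℂ a, ‖z‖ < 1) :
    Tendsto (fun n : ℕ => a ^ n) atTop (𝓝 0) := by
  have hr : spectralRadius ℂ a < 1 := by
    have := spectrum.spectralRadius_lt_of_forall_lt a (r := 1) (fun z hz => by
      have := h z hz
      exact_mod_cast this)
    simpa using this
  obtain ⟨s, hs, hs1⟩ := exists_between hr
  lift s to NNReal using (hs1.trans ENNReal.one_lt_top).ne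
  have hs1' : s < 1 := by exact_mod_cast hs1
  have hG := spectrum.pow_nnnorm_pow_one_div_tendsto_nhds_spectralRadius a
  have hev := hG.eventually (gt_mem_nhds hs)
  refine squeeze_zero_norm' (a := fun n : ℕ => (s : ℝ) ^ n) ?_
    (tendsto_pow_atTop_nhds_zero_of_lt_one s.2 (by exact_mod_cast hs1'))
  filter_upwards [hev, eventually_gt_atTop 0] with n hn hn0
  have hn' : (0 : ℝ) < n := by exact_mod_cast hn0
  have h1 : ((‖a ^ n‖₊ : ENNReal) ^ (1 / (n : ℝ))) ^ (n : ℝ) ≤ (s : ENNReal) ^ (n : ℝ) :=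
    ENNReal.rpow_le_rpow hn.le hn'.le
  rw [← ENNReal.rpow_mul, one_div, inv_mul_cancel₀ hn'.ne', ENNReal.rpow_one,
    ENNReal.rpow_natCast] at h1
  have h2 : ‖a ^ n‖₊ ≤ s ^ n := by exact_mod_cast h1
  exact_mod_cast h2

section Field

variable {K ι : Type*} [Field K] [Fintype ι] [DecidableEq ι]

theorem exists_spectral_projection (A : Matrix ι ι K) (lam : K)
    (h : A.charpoly.rootMultiplicity lam = 1) :
    ∃ P : Matrix ι ι K, Commute A P ∧ A * P = lam • P ∧
      ∀ z : ι → K, A.mulVec z = lam • z → P.mulVec z = z := by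
  obtain ⟨q, hq, hdvd⟩ := Polynomial.exists_eq_pow_rootMultiplicity_mul_and_not_dvd A.charpoly
    A.charpoly_monic.ne_zero lam
  rw [h, pow_one] at hq
  have hql : q.eval lam ≠ 0 := fun h0 => hdvd (Polynomial.dvd_iff_isRoot.2 h0)
  refine ⟨(q.eval lam)⁻¹ • Polynomial.aeval A q, ?_, ?_, ?_⟩
  · refine Commute.smul_right ?_ _
    have := (Polynomial.commute_X q).map (Polynomial.aeval A)
    rw [Polynomial.aeval_X] at this
    exact this
  · have h0 : Polynomial.aeval A A.charpoly = 0 := Matrix.aeval_self_charpoly A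
    rw [hq, map_mul, map_sub, Polynomial.aeval_X, Polynomial.aeval_C, sub_mul, sub_eq_zero,
      Algebra.algebraMap_eq_smul_one, smul_mul_assoc, one_mul] at h0
    rw [mul_smul_comm, h0, smul_comm]
  · intro z hz
    have key : ∀ p : Polynomial K, (Polynomial.aeval A p).mulVec z = p.eval lam • z := by
      intro p
      induction p using Polynomial.induction_on' with
      | add p q hp hq => simp [Matrix.add_mulVec, hp, hq, add_smul]
      | monomial n a =>
        have : ∀ n : ℕ, (A ^ n).mulVec z = lam ^ n • z := by
          intro n
          induction n with
          | zero => simp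
          | succ n ih => rw [pow_succ, ← Matrix.mulVec_mulVec, hz, Matrix.mulVec_smul, ih, smul_smul,
              pow_succ']
        rw [Polynomial.aeval_monomial, Polynomial.eval_monomial, ← Algebra.smul_def,
          Matrix.smul_mulVec, this, smul_smul]
    rw [Matrix.smul_mulVec, key, smul_smul, inv_mul_cancel₀ hql, one_smul]

theorem eq_vecMulVec_of_projection (A P : Matrix ι ι K) (lam : K)
    (h : A.charpoly.rootMultiplicity lam = 1) (hAP : A * P = lam • P)
    (hfix : ∀ z : ι → K, A.mulVec z = lam • z → P.mulVec z = z) :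
    ∃ v w : ι → K, w ⬝ᵥ v = 1 ∧ P = Matrix.vecMulVec v w := by
  have hfr := LinearMap.finrank_eigenspace_le (Matrix.toLin' A) lam
  rw [Matrix.charpoly_toLin', h] at hfr
  rw [Submodule.finrank_le_one_iff_isPrincipal] at hfr
  obtain ⟨⟨v, hv⟩⟩ := hfr
  have hmem : ∀ z : ι → K, A.mulVec z = lam • z ↔ ∃ c : K, c • v = z := by
    intro z
    rw [← Submodule.mem_span_singleton, ← hv, Module.End.mem_eigenspace_iff, Matrix.toLin'_apply]
  have hcol : ∀ j, ∃ c : K, c • v = P.col j := by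
    intro j
    rw [← hmem]
    ext i
    have := congrFun (congrFun hAP i) j
    simpa [Matrix.mul_apply, Matrix.mulVec, dotProduct] using this
  choose w hw using hcol
  have hP : P = Matrix.vecMulVec v w := by
    ext i j
    have := congrFun (hw j) i
    simp only [Pi.smul_apply, smul_eq_mul, Matrix.col_apply] at this
    rw [Matrix.vecMulVec_apply, ← this, mul_comm]
  refine ⟨v, w, ?_, hP⟩
  have hv0 : v ≠ 0 := by
    intro h0
    have hroot : A.charpoly.IsRoot lam :=
      (Polynomial.rootMultiplicity_pos A.charpoly_monic.ne_zero).1 (by omega)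
    have hev : Module.End.HasEigenvalue (Matrix.toLin' A) lam := by
      rw [Module.End.hasEigenvalue_iff_isRoot_charpoly, Matrix.charpoly_toLin']
      exact hroot
    apply hev
    change Module.End.eigenspace (Matrix.toLin' A) lam = ⊥
    rw [hv, h0, Submodule.span_zero_singleton]
  have hvv := hfix v ((hmem v).2 ⟨1, one_smul _ _⟩)
  rw [hP, Matrix.vecMulVec_mulVec] at hvv
  obtain ⟨i, hi⟩ := Function.ne_iff.1 hv0
  have := congrFun hvv i
  simp only [Pi.smul_apply, MulOpposite.smul_eq_mul_unop, MulOpposite.unop_op] at this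
  exact mul_left_cancel₀ hi (by rw [this, mul_one])

theorem sub_smul_projection_pow {A P : Matrix ι ι K} {lam : K} (hc : Commute A P)
    (hAP : A * P = lam • P) (hPP : P * P = P) (n : ℕ) :
    (A - lam • P) ^ (n + 1) = A ^ (n + 1) - lam ^ (n + 1) • P := by
  have hPA : P * A = lam • P := hc.eq ▸ hAP
  have hAn : ∀ k : ℕ, A ^ k * P = lam ^ k • P := by
    intro k
    induction k with
    | zero => simp
    | succ k ih => rw [pow_succ, mul_assoc, hAP, mul_smul_comm, ih, smul_smul, pow_succ']
  induction n with
  | zero => simp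
  | succ n ih =>
    rw [pow_succ, ih, sub_mul, mul_sub, mul_sub, ← pow_succ, mul_smul_comm, hAn, smul_mul_assoc,
      smul_mul_assoc, hPA, mul_smul_comm, hPP, smul_smul, smul_smul]
    rw [show lam * lam ^ (n + 1) = lam ^ (n + 1 + 1) by ring,
      show lam ^ (n + 1) * lam = lam ^ (n + 1 + 1) by ring]
    abel

end Field

theorem Matrix.mem_spectrum_iff_exists_mulVec {K ι : Type*} [Field K] [Fintype ι] [DecidableEq ι]
    (A : Matrix ι ι K) (z : K) :
    z ∈ spectrum K A ↔ ∃ x : ι → K, x ≠ 0 ∧ A.mulVec x = z • x := by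
  rw [← Matrix.spectrum_toLin', ← Module.End.hasEigenvalue_iff_mem_spectrum]
  constructor
  · intro h
    obtain ⟨x, hx⟩ := h.exists_hasEigenvector
    exact ⟨x, hx.2, by simpa using hx.apply_eq_smul⟩
  · rintro ⟨x, hx, h⟩
    exact Module.End.hasEigenvalue_of_hasEigenvector
      ⟨Module.End.mem_eigenspace_iff.2 (by simpa using h), hx⟩

theorem Matrix.tendsto_pow_apply_zero {ι : Type*} [Fintype ι] [DecidableEq ι]
    (N : Matrix ι ι ℂ) (h : ∀ z ∈ spectrum ℂ N, ‖z‖ < 1) (i j : ι) :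
    Tendsto (fun n : ℕ => (N ^ n) i j) atTop (𝓝 0) := by
  let : NormedRing (Matrix ι ι ℂ) := Matrix.linftyOpNormedRing
  let : NormedAlgebra ℂ (Matrix ι ι ℂ) := Matrix.linftyOpNormedAlgebra
  have : Nonempty ι := ⟨i⟩
  have : CompleteSpace (Matrix ι ι ℂ) := FiniteDimensional.complete ℂ _
  have h1 := tendsto_pow_zero_of_spectrum_lt_one N h
  have hc : Continuous (Matrix.entryLinearMap ℂ ℂ i j : Matrix ι ι ℂ →ₗ[ℂ] ℂ) :=
    LinearMap.continuous_of_finiteDimensional _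
  have h2 := (hc.tendsto 0).comp h1
  simpa [Function.comp_def] using h2

/-- Power iteration: the normalised powers of a real matrix with a simple dominating real
eigenvalue converge to a matrix of rank one. -/
theorem exists_tendsto_pow_div {ι : Type*} [Fintype ι] [DecidableEq ι] (A : Matrix ι ι ℝ)
    (lam : ℝ) (hlam : lam ≠ 0)
    (hsimple : (A.map (algebraMap ℝ ℂ)).charpoly.rootMultiplicity (lam : ℂ) = 1)
    (hdom : ∀ z ∈ spectrum ℂ (A.map (algebraMap ℝ ℂ)), z ≠ (lam : ℂ) → ‖z‖ < |lam|) :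
    ∃ v w : ι → ℝ, w ⬝ᵥ v = 1 ∧
      ∀ i j, Tendsto (fun n : ℕ => (A ^ n) i j / lam ^ n) atTop (𝓝 (v i * w j)) := by
  have hs : A.charpoly.rootMultiplicity lam = 1 := by
    rw [← hsimple, Matrix.charpoly_map]
    exact Polynomial.eq_rootMultiplicity_map (algebraMap ℝ ℂ).injective lam
  obtain ⟨P, hc, hAP, hfix⟩ := exists_spectral_projection A lam hs
  have hPP : P * P = P := by
    ext i j
    have hz : A.mulVec (P.col j) = lam • P.col j := by
      ext k
      have := congrFun (congrFun hAP k) j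
      simpa [Matrix.mul_apply, Matrix.mulVec, dotProduct] using this
    have := congrFun (hfix _ hz) i
    simpa [Matrix.mul_apply, Matrix.mulVec, dotProduct] using this
  obtain ⟨v, w, hwv, hP⟩ := eq_vecMulVec_of_projection A P lam hs hAP hfix
  refine ⟨v, w, hwv, ?_⟩
  set f : Matrix ι ι ℝ →+* Matrix ι ι ℂ := (algebraMap ℝ ℂ).mapMatrix with hf
  have hfA : f A = A.map (algebraMap ℝ ℂ) := rfl
  have hfs : ∀ (c : ℝ) (X : Matrix ι ι ℝ), f (c • X) = (c : ℂ) • f X := by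
    intro c X; ext i j; simp [hf]
  rw [← hfA] at hsimple hdom
  have hPz : ∀ x : ι → ℂ, (f A).mulVec x = (lam : ℂ) • x → (f P).mulVec x = x := by
    intro x hx
    have hre : ∀ (X : Matrix ι ι ℝ) (i : ι), ((f X).mulVec x i).re
        = X.mulVec (fun j => (x j).re) i := by
      intro X i; simp [hf, Matrix.mulVec, dotProduct]
    have him : ∀ (X : Matrix ι ι ℝ) (i : ι), ((f X).mulVec x i).im
        = X.mulVec (fun j => (x j).im) i := by
      intro X i; simp [hf, Matrix.mulVec, dotProduct]
    have h1 := hfix (fun j => (x j).re) (by ext i; rw [← hre, hx]; simp)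
    have h2 := hfix (fun j => (x j).im) (by ext i; rw [← him, hx]; simp)
    ext i
    apply Complex.ext
    · rw [hre, h1]
    · rw [him, h2]
  have hspec : ∀ z ∈ spectrum ℂ ((lam : ℂ)⁻¹ • f (A - lam • P)), ‖z‖ < 1 := by
    intro z hz
    obtain ⟨x, hx, hxz⟩ := (Matrix.mem_spectrum_iff_exists_mulVec _ _).1 hz
    have hlc : (lam : ℂ) ≠ 0 := by exact_mod_cast hlam
    by_cases hz0 : z = 0
    · simp [hz0]
    have hN : (f (A - lam • P)).mulVec x = ((lam : ℂ) * z) • x := by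
      rw [mul_smul, ← hxz, Matrix.smul_mulVec, smul_smul, mul_inv_cancel₀ hlc, one_smul]
    have hPN : P * (A - lam • P) = 0 := by
      rw [mul_sub, ← hc.eq, hAP, mul_smul_comm, hPP, sub_self]
    have hPx : (f P).mulVec x = 0 := by
      have h1 : (f P).mulVec ((f (A - lam • P)).mulVec x) = 0 := by
        rw [Matrix.mulVec_mulVec, ← map_mul, hPN, map_zero, Matrix.zero_mulVec]
      rw [hN, Matrix.mulVec_smul] at h1
      exact (smul_eq_zero.1 h1).resolve_left (mul_ne_zero hlc hz0)
    have hAx : (f A).mulVec x = ((lam : ℂ) * z) • x := by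
      rw [map_sub, hfs, Matrix.sub_mulVec, Matrix.smul_mulVec, hPx, smul_zero, sub_zero] at hN
      exact hN
    have hne : (lam : ℂ) * z ≠ lam := by
      intro he
      rw [he] at hAx
      exact hx ((hPz x hAx).symm.trans hPx)
    have := hdom _ ((Matrix.mem_spectrum_iff_exists_mulVec _ _).2 ⟨x, hx, hAx⟩) hne
    rw [norm_mul, Complex.norm_real, Real.norm_eq_abs] at this
    have hl : 0 < |lam| := abs_pos.2 hlam
    nlinarith
  intro i j
  have hlim := Matrix.tendsto_pow_apply_zero _ hspec i j
  have hre := (Complex.continuous_re.tendsto _).comp hlim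
  rw [← tendsto_sub_nhds_zero_iff]
  refine hre.congr' ?_
  filter_upwards [eventually_gt_atTop 0] with n hn
  obtain ⟨k, rfl⟩ := Nat.exists_eq_succ_of_ne_zero hn.ne'
  have hpow := sub_smul_projection_pow hc hAP hPP k
  have : ((lam : ℂ)⁻¹ • f (A - lam • P)) ^ (k + 1)
      = f ((lam ^ (k + 1))⁻¹ • (A ^ (k + 1) - lam ^ (k + 1) • P)) := by
    rw [smul_pow, ← map_pow, hpow, hfs]
    simp
  have hl : lam ^ (k + 1) ≠ 0 := pow_ne_zero _ hlam
  rw [Function.comp_apply, Nat.succ_eq_add_one, this]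
  simp only [hf, RingHom.mapMatrix_apply, Matrix.map_apply, Complex.coe_algebraMap,
    Complex.ofReal_re, Matrix.smul_apply, Matrix.sub_apply, smul_eq_mul, hP,
    Matrix.vecMulVec_apply]
  field_simp

section Transvection

variable {ι R : Type*} [Fintype ι] [CommRing R] {L : Matrix ι ι R}

theorem dotProduct_mulVec_skew (hL : Lᵀ = -L) (x y : ι → R) :
    x ⬝ᵥ L *ᵥ y = -(y ⬝ᵥ L *ᵥ x) := by
  rw [dotProduct_comm y, ← vecMul_transpose, hL, vecMul_neg, dotProduct_neg,
    dotProduct_comm x, ← dotProduct_mulVec, dotProduct_comm y]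

theorem dotProduct_mulVec_self_skew [IsDomain R] [CharZero R] (hL : Lᵀ = -L) (x : ι → R) :
    x ⬝ᵥ L *ᵥ x = 0 :=
  self_eq_neg.1 (dotProduct_mulVec_skew hL x x)

variable [DecidableEq ι]

/-- The transvection `z ↦ z + t ω(a, z) a` of the bilinear form `ω` with Gram matrix `L`. -/
def formTransvection (L : Matrix ι ι R) (a : ι → R) (t : R) : Matrix ι ι R :=
  1 + t • vecMulVec a (a ᵥ* L)

theorem formTransvection_mulVec (L : Matrix ι ι R) (a : ι → R) (t : R) (z : ι → R) :
    formTransvection L a t *ᵥ z = z + (t * (a ⬝ᵥ L *ᵥ z)) • a := by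
  ext i
  simp [formTransvection, add_mulVec, smul_mulVec, vecMulVec_mulVec, dotProduct_mulVec]
  ring

theorem formTransvection_map {R' : Type*} [CommRing R'] (f : R →+* R') (L : Matrix ι ι R)
    (a : ι → R) (t : R) :
    (formTransvection L a t).map f = formTransvection (L.map f) (f ∘ a) (f t) := by
  ext i j
  simp [formTransvection, vecMulVec_apply, vecMul, dotProduct, Matrix.one_apply, apply_ite f]

theorem formTransvection_mul_neg [IsDomain R] [CharZero R] (hL : Lᵀ = -L) (a : ι → R) (t : R) :
    formTransvection L a t * formTransvection L a (-t) = 1 := by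
  refine Matrix.ext_of_mulVec_single fun i => ?_
  rw [← mulVec_mulVec, formTransvection_mulVec, formTransvection_mulVec, mulVec_add, mulVec_smul,
    dotProduct_add, dotProduct_smul, dotProduct_mulVec_self_skew hL, one_mulVec]
  module

theorem formTransvection_transpose_mul_mul [IsDomain R] [CharZero R] (hL : Lᵀ = -L) (a : ι → R)
    (t : R) :
    (formTransvection L a t)ᵀ * L * formTransvection L a t = L := by
  have h0 := dotProduct_mulVec_self_skew hL a
  have h1 : L *ᵥ a = -(a ᵥ* L) := by rw [← mulVec_transpose, hL, neg_mulVec, neg_neg]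
  have h2 : (a ᵥ* L) ⬝ᵥ a = 0 := by rw [← dotProduct_mulVec, h0]
  simp only [formTransvection, transpose_add, transpose_one, transpose_smul, transpose_vecMulVec,
    add_mul, mul_add, one_mul, mul_one, smul_mul_assoc, mul_smul_comm, vecMulVec_mul,
    mul_vecMulVec, h1, vecMulVec_mulVec, h2]
  ext i j
  simp [vecMulVec_apply]

/-- The transvection as an element of the group preserving the form. -/
def formTransvectionGL {m : ℕ} [IsDomain R] [CharZero R] {L : Matrix (Fin m) (Fin m) R}
    (hL : Lᵀ = -L) (a : Fin m → R) (t : R) : GeneralLinearGroup (Fin m) R where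
  val := formTransvection L a t
  inv := formTransvection L a (-t)
  val_inv := formTransvection_mul_neg hL a t
  inv_val := by simpa using formTransvection_mul_neg hL a (-t)

theorem formTransvectionGL_mem {m : ℕ} [IsDomain R] [CharZero R] {L : Matrix (Fin m) (Fin m) R}
    (hL : Lᵀ = -L) (a : Fin m → R) (t : R) :
    formTransvectionGL hL a t ∈ formPreservingGroup L :=
  formTransvection_transpose_mul_mul hL a t

end Transvection

section Real

variable {ι : Type*} [Fintype ι] [DecidableEq ι]

theorem exists_pos_dotProduct_ne_zero {p : ι → ℝ} (hp : p ≠ 0) :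
    ∃ w : ι → ℝ, (∀ i, 0 < w i) ∧ p ⬝ᵥ w ≠ 0 := by
  obtain ⟨i, hi⟩ := Function.ne_iff.1 hp
  by_cases h : p ⬝ᵥ (1 : ι → ℝ) = 0
  · refine ⟨1 + Pi.single i 1, fun j => ?_, ?_⟩
    · have : (0 : ι → ℝ) ≤ Pi.single i 1 := Pi.single_nonneg.2 zero_le_one
      have := this j
      simp only [Pi.add_apply, Pi.one_apply, Pi.zero_apply] at this ⊢
      linarith
    · rw [dotProduct_add, h, zero_add, dotProduct_single, mul_one]
      exact hi
  · exact ⟨1, fun _ => one_pos, h⟩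

/-- Two transvections suffice to move a vector into the positive orthant and, at the same time, a
covector not vanishing on it into the dual positive orthant. -/
theorem exists_formTransvection_pos {L : Matrix ι ι ℝ} (hL : Lᵀ = -L) (hdet : L.det ≠ 0)
    {v u : ι → ℝ} (huv : v ⬝ᵥ L *ᵥ u = 1) :
    ∃ (a : ι → ℝ) (t : ℝ) (b : ι → ℝ) (s : ℝ),
      (∀ i, 0 < ((formTransvection L b s * formTransvection L a t) *ᵥ v) i) ∧
      ∀ i, 0 < (L *ᵥ ((formTransvection L b s * formTransvection L a t) *ᵥ u)) i := by
  have hpres : ∀ a t x y,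
      (formTransvection L a t *ᵥ x) ⬝ᵥ L *ᵥ (formTransvection L a t *ᵥ y) = x ⬝ᵥ L *ᵥ y := by
    intro a t x y
    conv_rhs => rw [← formTransvection_transpose_mul_mul hL a t]
    rw [← mulVec_mulVec, ← mulVec_mulVec, dotProduct_mulVec _ (formTransvection L a t)ᵀ,
      vecMul_transpose]
  have hunit : IsUnit L.det := isUnit_iff_ne_zero.2 hdet
  have hv : v ≠ 0 := by rintro rfl; simp at huv
  have hLv : L *ᵥ v ≠ 0 := fun h => hv (eq_zero_of_mulVec_eq_zero hdet h)
  obtain ⟨x, hx, hxv⟩ := exists_pos_dotProduct_ne_zero hLv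
  rw [dotProduct_comm] at hxv
  set a := x - v with ha
  set t := (x ⬝ᵥ L *ᵥ v)⁻¹ with ht
  have hTv : formTransvection L a t *ᵥ v = x := by
    rw [formTransvection_mulVec, ha, sub_dotProduct, dotProduct_mulVec_self_skew hL, sub_zero, ht,
      inv_mul_cancel₀ hxv, one_smul]
    abel
  set u' := formTransvection L a t *ᵥ u with hu'
  have hxu' : x ⬝ᵥ L *ᵥ u' = 1 := by rw [← hTv, hu', hpres, huv]
  have hu'0 : u' ≠ 0 := by intro h; rw [h] at hxu'; simp at hxu'
  obtain ⟨w₀, hw₀, huw₀⟩ := exists_pos_dotProduct_ne_zero hu'0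
  have hne : (Finset.univ : Finset ι).Nonempty := by
    obtain ⟨i, -⟩ := Function.ne_iff.1 hv
    exact ⟨i, Finset.mem_univ i⟩
  have hxw₀ : 0 < x ⬝ᵥ w₀ := Finset.sum_pos (fun i _ => mul_pos (hx i) (hw₀ i)) hne
  set w := (x ⬝ᵥ w₀)⁻¹ • w₀ with hw
  have hxw : x ⬝ᵥ w = 1 := by rw [hw, dotProduct_smul, smul_eq_mul, inv_mul_cancel₀ hxw₀.ne']
  have huw : u' ⬝ᵥ w ≠ 0 := by
    rw [hw, dotProduct_smul]
    exact mul_ne_zero (inv_ne_zero hxw₀.ne') huw₀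
  set y := L⁻¹ *ᵥ w with hy
  have hLy : L *ᵥ y = w := by rw [hy, mulVec_mulVec, mul_nonsing_inv _ hunit, one_mulVec]
  set b := y - u' with hb
  have hyu : y ⬝ᵥ L *ᵥ u' ≠ 0 := by
    rw [dotProduct_mulVec_skew hL, hLy]
    exact neg_ne_zero.2 huw
  set s := (y ⬝ᵥ L *ᵥ u')⁻¹ with hs
  refine ⟨a, t, b, s, fun i => ?_, fun i => ?_⟩
  · have : formTransvection L b s *ᵥ x = x := by
      rw [formTransvection_mulVec, dotProduct_mulVec_skew hL, hb, mulVec_sub, dotProduct_sub, hLy,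
        hxw, hxu']
      simp
    rw [← mulVec_mulVec, hTv, this]
    exact hx i
  · have : formTransvection L b s *ᵥ u' = y := by
      rw [formTransvection_mulVec, hb, sub_dotProduct, dotProduct_mulVec_self_skew hL, sub_zero, hs,
        inv_mul_cancel₀ hyu, one_smul]
      abel
    rw [← mulVec_mulVec, ← hu', this, hLy]
    exact mul_pos (inv_pos.2 hxw₀) (hw₀ i)

theorem continuous_formTransvection (L : Matrix ι ι ℝ) :
    Continuous fun p : (ι → ℝ) × ℝ => formTransvection L p.1 p.2 := by
  unfold formTransvection
  refine continuous_const.add (continuous_snd.smul ?_)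
  exact continuous_fst.matrix_vecMulVec (continuous_fst.matrix_vecMul continuous_const)

/-- A vector and a covector pairing to `1` can be moved into the positive orthants by a rational
matrix preserving the form. -/
theorem exists_rational_formPreserving_pos {m : ℕ} {L : Matrix (Fin m) (Fin m) ℚ} (hL : Lᵀ = -L)
    (hdet : L.det ≠ 0) {v w : Fin m → ℝ} (hwv : w ⬝ᵥ v = 1) :
    ∃ T ∈ formPreservingGroup L,
      (∀ i, 0 < (T.val.map (Rat.castHom ℝ) *ᵥ v) i) ∧
      ∀ i, 0 < (w ᵥ* (T⁻¹).val.map (Rat.castHom ℝ)) i := by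
  set c := Rat.castHom ℝ with hc
  set LR : Matrix (Fin m) (Fin m) ℝ := L.map c with hLR
  have hLRs : LRᵀ = -LR := by
    rw [hLR, ← transpose_map, hL]; ext i j; simp
  have hLRd : LR.det ≠ 0 := by
    have : LR.det = c L.det := (c.map_det L).symm
    rw [this]
    exact (map_ne_zero c).2 hdet
  obtain ⟨u, hLu⟩ : ∃ u, LR *ᵥ u = w := ⟨LR⁻¹ *ᵥ w, by
    rw [mulVec_mulVec, mul_nonsing_inv _ (isUnit_iff_ne_zero.2 hLRd), one_mulVec]⟩
  obtain ⟨a, t, b, s, h1, h2⟩ := exists_formTransvection_pos hLRs hLRd (v := v) (u := u)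
    (by rw [hLu, dotProduct_comm, hwv])
  let F : ((Fin m → ℝ) × ℝ) × ((Fin m → ℝ) × ℝ) → Matrix (Fin m) (Fin m) ℝ := fun p =>
    formTransvection LR p.2.1 p.2.2 * formTransvection LR p.1.1 p.1.2
  have hF : Continuous F :=
    ((continuous_formTransvection LR).comp continuous_snd).matrix_mul
      ((continuous_formTransvection LR).comp continuous_fst)
  have hU : IsOpen {p | (∀ i, 0 < (F p *ᵥ v) i) ∧ ∀ i, 0 < (LR *ᵥ (F p *ᵥ u)) i} := by
    simp only [Set.ofPred_and, Set.ofPred_forall]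
    have hFv : ∀ z, Continuous fun p => F p *ᵥ z := fun z => hF.matrix_mulVec continuous_const
    exact (isOpen_iInter_of_finite fun i =>
        isOpen_lt continuous_const ((continuous_apply i).comp (hFv v))).inter
      (isOpen_iInter_of_finite fun i => isOpen_lt continuous_const
        ((continuous_apply i).comp (continuous_const.matrix_mulVec (hFv u))))
  have hd1 : DenseRange (Prod.map (fun a : Fin m → ℚ => fun i => ((a i : ℚ) : ℝ))
      (Rat.cast : ℚ → ℝ)) :=
    (DenseRange.piMap fun _ => Rat.denseRange_cast).prodMap Rat.denseRange_cast
  obtain ⟨⟨⟨a', t'⟩, b', s'⟩, h1', h2'⟩ := (hd1.prodMap hd1).exists_mem_open hU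
    ⟨((a, t), b, s), h1, h2⟩
  set T := formTransvectionGL hL b' s' * formTransvectionGL hL a' t' with hT
  have hTF : T.val.map c = F ((fun i => ((a' i : ℚ) : ℝ), t'), fun i => ((b' i : ℚ) : ℝ), s') := by
    have : T.val = formTransvection L b' s' * formTransvection L a' t' := rfl
    rw [this, Matrix.map_mul, formTransvection_map, formTransvection_map]
    rfl
  have hTm : T ∈ formPreservingGroup L :=
    mul_mem (formTransvectionGL_mem hL _ _) (formTransvectionGL_mem hL _ _)
  refine ⟨T, hTm, ?_, ?_⟩
  · rw [hTF]; exact h1'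
  · have hTL : (T.val.map c)ᵀ * LR * T.val.map c = LR := by
      rw [hLR, ← transpose_map, ← Matrix.map_mul, ← Matrix.map_mul]
      exact congrArg (fun X => X.map c) hTm
    have hinv : T.val.map c * (T⁻¹).val.map c = 1 := by
      rw [← Matrix.map_mul, ← Units.val_mul, mul_inv_cancel]
      simp
    have hrow : w ᵥ* (T⁻¹).val.map c = LR *ᵥ (T.val.map c *ᵥ u) := by
      have hLT : (T.val.map c)ᵀ * (LR * T.val.map c) = LR := by rw [← Matrix.mul_assoc, hTL]
      have hti : ((T⁻¹).val.map c)ᵀ * (T.val.map c)ᵀ = 1 := by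
        rw [← transpose_mul, hinv, transpose_one]
      have hmat : ((T⁻¹).val.map c)ᵀ * LR = LR * T.val.map c := by
        conv_lhs => rw [← hLT]
        rw [← Matrix.mul_assoc, hti, Matrix.one_mul]
      rw [← mulVec_transpose, ← hLu, mulVec_mulVec, mulVec_mulVec, hmat]
    rw [hrow, hTF]
    exact h2'

end Real

theorem exists_pow_eq_one_add_smul {m : ℕ} (M : GeneralLinearGroup (Fin m) ℤ) (q : ℕ)
    (hq : q ≠ 0) :
    ∃ k > 0, ∀ j : ℕ, ∃ E : Matrix (Fin m) (Fin m) ℤ, (M ^ (k * j)).val = 1 + (q : ℤ) • E := by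
  have : NeZero q := ⟨hq⟩
  set f := GeneralLinearGroup.map (n := Fin m) (Int.castRingHom (ZMod q)) with hf
  refine ⟨orderOf (f M), orderOf_pos _, fun j => ?_⟩
  have h1 : f (M ^ (orderOf (f M) * j)) = 1 := by
    rw [map_pow, pow_mul, pow_orderOf_eq_one, one_pow]
  have h2 : ∀ i l, (q : ℤ) ∣ ((M ^ (orderOf (f M) * j)).val - 1) i l := by
    intro i l
    rw [← ZMod.intCast_zmod_eq_zero_iff_dvd]
    have := congrArg (fun X : GeneralLinearGroup (Fin m) (ZMod q) => X.val i l) h1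
    simp only [hf, GeneralLinearGroup.map_apply, Units.val_one] at this
    rw [Matrix.sub_apply, Int.cast_sub, sub_eq_zero]
    refine this.trans ?_
    by_cases hil : i = l <;> simp [Matrix.one_apply, hil]
  choose E hE using h2
  refine ⟨Matrix.of E, ?_⟩
  ext i l
  have := hE i l
  simp only [Matrix.sub_apply, Matrix.add_apply, Matrix.smul_apply, Matrix.of_apply,
    smul_eq_mul] at this ⊢
  linarith

/-- An integer matrix preserving a non-degenerate form is invertible over `ℤ`. -/
theorem exists_mem_formPreservingGroup_of_preserves {m : ℕ} {L N : Matrix (Fin m) (Fin m) ℤ}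
    (hdet : L.det ≠ 0) (hN : Nᵀ * L * N = L) :
    ∃ N' ∈ formPreservingGroup L, N'.val = N := by
  have h := congrArg Matrix.det hN
  rw [det_mul, det_mul, det_transpose] at h
  have h1 : N.det * N.det = 1 := mul_right_cancel₀ hdet (by linear_combination h)
  have hu : IsUnit N := (Matrix.isUnit_iff_isUnit_det N).2 (IsUnit.of_mul_eq_one _ h1)
  obtain ⟨N', rfl⟩ := hu
  exact ⟨N', hN, rfl⟩

theorem theoremT (g : ℕ) (L : Matrix (Fin (2 * g)) (Fin (2 * g)) ℤ)
    (hL : IsIntegralSymplecticForm L)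
    (M : Matrix.GeneralLinearGroup (Fin (2 * g)) ℤ) (hM : M ∈ formPreservingGroup L)
    (hdom : ∃ lam : ℝ, IsSimpleDominatingEigenvalue M.val lam) :
    ∃ n : ℕ, 0 < n ∧
      ∃ B : Matrix.GeneralLinearGroup (Fin (2 * g)) ℚ,
        -- `B` is an integer matrix, equal to a positive integer times a rational symplectic matrix
        (∃ C : Matrix (Fin (2 * g)) (Fin (2 * g)) ℤ, B.val = C.map (Int.cast : ℤ → ℚ)) ∧
        (∃ S ∈ formPreservingGroup (L.map (Int.cast : ℤ → ℚ)),
          ∃ a : ℕ, 0 < a ∧ B.val = (a : ℚ) • S.val) ∧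
        -- and `B⁻¹ Mⁿ B` is an integral Perron-Frobenius matrix that preserves `L`
        ∃ N ∈ formPreservingGroup L,
          B⁻¹ * Matrix.GeneralLinearGroup.map (Int.castRingHom ℚ) (M ^ n) * B =
            Matrix.GeneralLinearGroup.map (Int.castRingHom ℚ) N ∧
          (N.val.map (Int.cast : ℤ → ℝ)).IsPrimitive := by
  obtain ⟨lam, hd⟩ := hdom
  have hlam : lam ≠ 0 := by
    rintro rfl
    simpa using hd.one_lt_abs.trans' one_pos
  set A : Matrix (Fin (2 * g)) (Fin (2 * g)) ℝ := M.val.map (Int.cast : ℤ → ℝ) with hA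
  have hAC : A.map (algebraMap ℝ ℂ) = M.val.map (Int.cast : ℤ → ℂ) := by
    ext i j; simp [hA]
  obtain ⟨v, w, hwv, hlim⟩ := exists_tendsto_pow_div A lam hlam
    (by rw [hAC]; exact hd.simple) (by rw [hAC]; exact hd.dominates)
  set LQ : Matrix (Fin (2 * g)) (Fin (2 * g)) ℚ := L.map (Int.cast : ℤ → ℚ) with hLQ
  have hLQs : LQᵀ = -LQ := by
    rw [hLQ, ← transpose_map, hL.skew]; ext i j; simp
  have hLQd : LQ.det ≠ 0 := by
    have : LQ.det = (L.det : ℚ) := ((Int.castRingHom ℚ).map_det L).symm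
    rw [this]
    exact_mod_cast hL.nondegenerate
  obtain ⟨T, hT, hTv, hTw⟩ := exists_rational_formPreserving_pos hLQs hLQd hwv
  set S := T⁻¹ with hS
  have hSm : S ∈ formPreservingGroup LQ := inv_mem hT
  set a := S.val.den with ha
  set b := T.val.den with hb
  have ha0 : a ≠ 0 := S.val.den_ne_zero
  have hb0 : b ≠ 0 := T.val.den_ne_zero
  have haQ : (a : ℚ) ≠ 0 := by exact_mod_cast ha0
  have hbQ : (b : ℚ) ≠ 0 := by exact_mod_cast hb0
  have hC : (a : ℚ) • S.val = S.val.num.map (Int.cast : ℤ → ℚ) := by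
    conv_lhs => rw [← S.val.inv_denom_smul_num]
    rw [smul_smul, mul_inv_cancel₀ haQ, one_smul]
  have hD : (b : ℚ) • T.val = T.val.num.map (Int.cast : ℤ → ℚ) := by
    conv_lhs => rw [← T.val.inv_denom_smul_num]
    rw [smul_smul, mul_inv_cancel₀ hbQ, one_smul]
  have hTS : T.val * S.val = 1 := by rw [← Units.val_mul, hS, mul_inv_cancel, Units.val_one]
  have hST : S.val * T.val = 1 := by rw [← Units.val_mul, hS, inv_mul_cancel, Units.val_one]
  obtain ⟨k, hk, hmod⟩ := exists_pow_eq_one_add_smul M (a * b) (mul_ne_zero ha0 hb0)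
  set c := Rat.castHom ℝ with hc
  have hlim2 : ∀ i l, Tendsto (fun n : ℕ => (T.val.map c * A ^ n * S.val.map c) i l / lam ^ n)
      atTop (𝓝 ((T.val.map c *ᵥ v) i * (w ᵥ* S.val.map c) l)) := by
    intro i l
    have h1 : ∀ n : ℕ, (T.val.map c * A ^ n * S.val.map c) i l / lam ^ n
        = ∑ y, ∑ x, T.val.map c i x * ((A ^ n) x y / lam ^ n) * S.val.map c y l := by
      intro n
      simp only [Matrix.mul_apply, Finset.sum_mul, Finset.sum_div]
      refine Finset.sum_congr rfl fun y _ => Finset.sum_congr rfl fun x _ => by ring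
    have h2 : (T.val.map c *ᵥ v) i * (w ᵥ* S.val.map c) l
        = ∑ y, ∑ x, T.val.map c i x * (v x * w y) * S.val.map c y l := by
      simp only [mulVec, vecMul, dotProduct, Finset.sum_mul_sum]
      rw [Finset.sum_comm]
      refine Finset.sum_congr rfl fun y _ => Finset.sum_congr rfl fun x _ => by ring
    rw [h2]
    simp only [h1]
    exact tendsto_finsetSum _ fun y _ => tendsto_finsetSum _ fun x _ =>
      ((hlim x y).const_mul _).mul_const _
  have hev : ∀ᶠ n : ℕ in atTop, ∀ i l,
      0 < (T.val.map c * A ^ n * S.val.map c) i l / lam ^ n :=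
    eventually_all.2 fun i => eventually_all.2 fun l =>
      (hlim2 i l).eventually (lt_mem_nhds (mul_pos (hTv i) (hTw l)))
  obtain ⟨n₀, hn₀⟩ := eventually_atTop.1 hev
  set n := k * (2 * (n₀ + 1)) with hn
  have hnpos : 0 < n := by positivity
  have hn₀n : n₀ ≤ n := by nlinarith
  obtain ⟨E, hE⟩ := hmod (2 * (n₀ + 1))
  rw [← hn] at hE
  set N₀ : Matrix (Fin (2 * g)) (Fin (2 * g)) ℤ := 1 + T.val.num * E * S.val.num with hN₀
  have hE' : (M ^ n).val.map (Int.cast : ℤ → ℚ)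
      = 1 + ((a : ℚ) * b) • E.map (Int.cast : ℤ → ℚ) := by
    rw [hE]
    ext i l
    by_cases hil : i = l <;>
      simp only [Matrix.map_apply, Matrix.add_apply, Matrix.smul_apply, Matrix.one_apply, hil,
        smul_eq_mul] <;> push_cast <;> simp
  have hconj : T.val * (M ^ n).val.map (Int.cast : ℤ → ℚ) * S.val
      = N₀.map (Int.cast : ℤ → ℚ) := by
    have h1 : N₀.map (Int.cast : ℤ → ℚ) = 1 + T.val.num.map (Int.cast : ℤ → ℚ) *
        E.map (Int.cast : ℤ → ℚ) * S.val.num.map (Int.cast : ℤ → ℚ) := by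
      change (Int.castRingHom ℚ).mapMatrix N₀ = _
      rw [hN₀, map_add, map_mul, map_mul, map_one]
      rfl
    rw [h1, ← hC, ← hD, hE', mul_add, add_mul, mul_one, hTS]
    simp only [smul_mul_assoc, mul_smul_comm, smul_smul]
  have hMn : (M ^ n).valᵀ * L * (M ^ n).val = L := pow_mem hM n
  have hMnQ : ((M ^ n).val.map (Int.cast : ℤ → ℚ))ᵀ * LQ * (M ^ n).val.map (Int.cast : ℤ → ℚ)
      = LQ := by
    have := congrArg (Int.castRingHom ℚ).mapMatrix hMn
    rw [map_mul, map_mul] at this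
    exact this
  have hTm : T.valᵀ * LQ * T.val = LQ := hT
  have hSm' : S.valᵀ * LQ * S.val = LQ := hSm
  have hN₀L : N₀ᵀ * L * N₀ = L := by
    have hinj : Function.Injective ((Int.castRingHom ℚ).mapMatrix (m := Fin (2 * g))) :=
      Matrix.map_injective Int.cast_injective
    apply hinj
    rw [map_mul, map_mul]
    change (N₀.map (Int.cast : ℤ → ℚ))ᵀ * LQ * N₀.map (Int.cast : ℤ → ℚ) = LQ
    rw [← hconj, transpose_mul, transpose_mul]
    set X := (M ^ n).val.map (Int.cast : ℤ → ℚ)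
    calc S.valᵀ * (Xᵀ * T.valᵀ) * LQ * (T.val * X * S.val)
        = S.valᵀ * (Xᵀ * (T.valᵀ * LQ * T.val) * X) * S.val := by
          simp only [Matrix.mul_assoc]
      _ = LQ := by rw [hTm, hMnQ, hSm']
  obtain ⟨N, hN, hNv⟩ := exists_mem_formPreservingGroup_of_preserves hL.nondegenerate hN₀L
  refine ⟨n, hnpos, ⟨(a : ℚ) • S.val, (a : ℚ)⁻¹ • T.val, ?_, ?_⟩, ⟨_, hC⟩,
    ⟨S, hSm, a, Nat.pos_of_ne_zero ha0, rfl⟩, N, hN, ?_, ?_, 1, one_pos, ?_⟩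
  · rw [smul_mul_smul_comm, mul_inv_cancel₀ haQ, hST, one_smul]
  · rw [smul_mul_smul_comm, inv_mul_cancel₀ haQ, hTS, one_smul]
  · apply Units.ext
    change (a : ℚ)⁻¹ • T.val * (M ^ n).val.map (Int.cast : ℤ → ℚ) * ((a : ℚ) • S.val)
      = N.val.map (Int.cast : ℤ → ℚ)
    rw [hNv, ← hconj, smul_mul_assoc, smul_mul_smul_comm, inv_mul_cancel₀ haQ, one_smul]
  all_goals
    have hpos : ∀ i j, 0 < N.val.map (Int.cast : ℤ → ℝ) i j := by
      intro i j
      have h1 : N.val.map (Int.cast : ℤ → ℝ) = T.val.map c * A ^ n * S.val.map c := by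
        have h2 := congrArg c.mapMatrix hconj
        rw [map_mul, map_mul] at h2
        have h3 : c.mapMatrix ((M ^ n).val.map (Int.cast : ℤ → ℚ)) = A ^ n := by
          have : A ^ n = (Int.castRingHom ℝ).mapMatrix ((M ^ n).val) := by
            rw [Units.val_pow_eq_pow_val, map_pow]
            rfl
          rw [this]
          ext i j
          simp
        rw [h3] at h2
        have h4 : c.mapMatrix (N₀.map (Int.cast : ℤ → ℚ)) = N₀.map (Int.cast : ℤ → ℝ) := by
          ext i j
          simp
        rw [hNv, ← h4, ← h2]
        rfl
      have hln : 0 < lam ^ n := (Even.pow_pos ⟨k * (n₀ + 1), by rw [hn]; ring⟩ hlam)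
      rw [h1]
      exact (div_pos_iff_of_pos_right hln).1 (hn₀ n hn₀n i j)
  · exact fun i j => (hpos i j).le
  · simpa using hpos
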